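/- Let $X$ be a set of positive integers and let $X^* = X \setminus \{1\}$. The common divisor simplicial complex $\mathcal{G}(X)$ has vertex set $X^*$, and a nonempty finite set $V \subseteq X^*$ is a simplex of $\mathcal{G}(X)$ if and only if $\gcd(V) > 1$. The prime divisor simplicial complex $\mathcal{D}(X)$ has as vertices the primes dividing at least one element of $X^*$, and a nonempty finite set $Q$ of such primes is a simplex of $\mathcal{D}(X)$ if and only if there is an element $v \in X$ that is divisible by every element of $Q$. Let $|K|$ denote the geometric realization of a simplicial complex $K$, with its standard (weak) topology. If $|\mathcal{G}(X)|$ is connected (equivalently, if $|\mathcal{D}(X)|$ is connected), then the first homology groups of $\mathcal{G}(X)$ and $\mathcal{D}(X)$ are isomorphic: $$H_1(|\mathcal{G}(X)|; \mathbb{Z}) \cong H_1(|\mathcal{D}(X)|; \mathbb{Z}),$$ where $H_1(\,\cdot\,;\mathbb{Z})$ is the first singular homology group. -/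

import Mathlib

open CategoryTheory

/-- The common divisor simplicial complex `𝒢(X)` of a set `X` of positive integers. Its vertices are
the elements of `X* = X \ {1}`; a nonempty finite set of vertices is a simplex iff its greatest
common divisor is greater than `1`. -/
def commonDivisorComplex (X : Set ℕ+) : AbstractSimplicialComplex {x : ℕ+ // x ∈ X ∧ x ≠ 1} where
  faces := {s | s.Nonempty ∧ 1 < s.gcd (fun v => ((v : ℕ+) : ℕ))}
  isRelLowerSet_faces := by
    rintro s ⟨hs, hgcd⟩
    refine ⟨hs, fun t hts ht => ⟨ht, ?_⟩⟩
    have hdvd : s.gcd (fun v => ((v : ℕ+) : ℕ)) ∣ t.gcd (fun v => ((v : ℕ+) : ℕ)) :=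
      Finset.gcd_mono hts
    obtain ⟨v, hv⟩ := ht
    have hpos : 0 < t.gcd (fun v => ((v : ℕ+) : ℕ)) :=
      Nat.pos_of_dvd_of_pos (Finset.gcd_dvd hv) v.1.pos
    exact lt_of_lt_of_le hgcd (Nat.le_of_dvd hpos hdvd)
  singleton_mem v := by
    refine ⟨Finset.singleton_nonempty v, ?_⟩
    have h1 : ((v : ℕ+) : ℕ) ≠ 1 := fun h => v.2.2 (PNat.coe_eq_one_iff.mp h)
    have h0 := v.1.pos
    simp only [Finset.gcd_singleton, normalize_eq]
    omega

/-- The prime divisor simplicial complex `𝒟(X)` of a set `X` of positive integers. Its vertices are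
the primes dividing at least one element of `X* = X \ {1}`; a nonempty finite set of vertices is a
simplex iff some element of `X` is divisible by all of its members. -/
def primeDivisorComplex (X : Set ℕ+) :
    AbstractSimplicialComplex {p : ℕ // p.Prime ∧ ∃ x ∈ X, x ≠ 1 ∧ p ∣ (x : ℕ)} where
  faces := {s | s.Nonempty ∧ ∃ x ∈ X, ∀ p ∈ s, (p : ℕ) ∣ (x : ℕ)}
  isRelLowerSet_faces := by
    rintro s ⟨hs, x, hx, hdvd⟩
    exact ⟨hs, fun t hts ht => ⟨ht, x, hx, fun p hp => hdvd p (hts hp)⟩⟩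
  singleton_mem p := by
    obtain ⟨x, hx, -, hpx⟩ := p.2.2
    exact ⟨Finset.singleton_nonempty p, x, hx, by simpa using hpx⟩

namespace AbstractSimplicialComplex

variable {ι : Type} (K : AbstractSimplicialComplex ι)

/-- The geometric realization `|K|` of an abstract simplicial complex: the families `(x i)` of
nonnegative barycentric coordinates with sum `1` whose support is a simplex of `K`. -/
def Realization : Type :=
  {x : ι →₀ ℝ // (∀ i, 0 ≤ x i) ∧ (x.sum fun _ a => a) = 1 ∧ x.support ∈ K.faces}

/-- The inclusion of the closed geometric simplex spanned by a simplex `s` of `K` into `|K|`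
(extension of the barycentric coordinates by zero). -/
noncomputable def Realization.ofFace (s : K.faces) (x : stdSimplex ℝ (s : Finset ι)) :
    K.Realization :=
  ⟨(Finsupp.equivFunOnFinite.symm x.1).embDomain
      (Function.Embedding.subtype _), by
    have hsum : (((Finsupp.equivFunOnFinite.symm x.1).embDomain
        (Function.Embedding.subtype _)).sum fun _ a => a) = 1 := by
      rw [Finsupp.sum_embDomain, Finsupp.sum_fintype _ _ (fun _ => rfl)]
      exact x.2.2
    refine ⟨fun i => ?_, hsum, ?_⟩
    · by_cases hi : i ∈ Set.range (Function.Embedding.subtype (· ∈ (s : Finset ι)))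
      · obtain ⟨j, rfl⟩ := hi
        rw [Finsupp.embDomain_apply_self]
        exact x.2.1 j
      · rw [Finsupp.embDomain_of_notMem_range _ _ _ hi]
    · refine (K.isRelLowerSet_faces s.2).2 ?_ ?_
      · intro i hi
        rw [Finsupp.support_embDomain, Finset.mem_map] at hi
        obtain ⟨j, -, rfl⟩ := hi
        exact j.2
      · rw [Finset.nonempty_iff_ne_empty, Ne, Finsupp.support_eq_empty]
        intro h0
        rw [h0, Finsupp.sum_zero_index] at hsum
        exact zero_ne_one hsum⟩

/-- The standard (weak, or coherent) topology on `|K|`: a set is open iff its intersection with each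
closed geometric simplex is open in that simplex. If `K` has finitely many vertices, this is the
topology of `|K|` as a subset of Euclidean space. -/
noncomputable instance : TopologicalSpace K.Realization :=
  ⨆ s : K.faces, TopologicalSpace.coinduced (Realization.ofFace K s) inferInstance

end AbstractSimplicialComplex

/-- The first singular homology group `H₁(Y; ℤ)` of a topological space `Y`. -/
noncomputable def firstHomology (Y : Type) [TopologicalSpace Y] : AddCommGrpCat.{0} :=
  ((AlgebraicTopology.singularHomologyFunctor AddCommGrpCat.{0} 1).obj
    (AddCommGrpCat.of ℤ)).obj (TopCat.of Y)

/-! Both complexes are Dowker complexes of the relation "p divides v" between elements of X* and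
primes: a finite set of numbers has gcd > 1 iff some prime is related to all of it, and a set of
primes is a simplex iff some number is related to all of it. Dowker duality makes the two
realizations homotopy equivalent, and singular homology is homotopy invariant.

Duality is proved by explicit maps, with no subdivision. Choose a common related element `c Q` for
each face Q. A point x is sent to a normalized combination of the finitely many vertices `c Q`, Q ⊆
supp x, each with coefficient `dowkerWeight` times a sum of monomials in the coordinates of x. The
weight of b vanishes unless b is related to every vertex a where x is maximal, so any such a
witnesses that the support of the image is a face. The same device in the other direction gives the
inverse, and straight-line homotopies through an intermediate self-map connect the composite to the
identity. -/

open scoped unitInterval NNReal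

/-! ### Maps and straight-line homotopies between geometric realizations. -/

namespace AbstractSimplicialComplex

namespace Realization

variable {ι κ : Type} {K : AbstractSimplicialComplex ι} {L : AbstractSimplicialComplex κ}

theorem continuous_iff_ofFace {Y : Type} [TopologicalSpace Y] {f : K.Realization → Y} :
    Continuous f ↔ ∀ s : K.faces, Continuous fun z => f (ofFace K s z) := by
  simp only [continuous_iSup_dom, continuous_coinduced_dom]
  rfl

theorem continuous_ofFace (s : K.faces) : Continuous (ofFace K s) :=
  continuous_iff_ofFace.1 continuous_id s

theorem ofFace_apply_of_mem (s : K.faces) (z : stdSimplex ℝ (s : Finset ι)) {i : ι}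
    (hi : i ∈ (s : Finset ι)) : (ofFace K s z).1 i = z.1 ⟨i, hi⟩ :=
  Finsupp.embDomain_apply_self (Function.Embedding.subtype _)
    (Finsupp.equivFunOnFinite.symm z.1) ⟨i, hi⟩

theorem ofFace_apply_of_notMem (s : K.faces) (z : stdSimplex ℝ (s : Finset ι)) {i : ι}
    (hi : i ∉ (s : Finset ι)) : (ofFace K s z).1 i = 0 :=
  Finsupp.embDomain_of_notMem_range _ _ _ (by simpa using hi)

theorem support_ofFace_subset (s : K.faces) (z : stdSimplex ℝ (s : Finset ι)) :
    (ofFace K s z).1.support ⊆ s := by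
  intro i hi
  by_contra h
  exact Finsupp.mem_support_iff.1 hi (ofFace_apply_of_notMem s z h)

theorem continuous_apply (i : ι) : Continuous fun x : K.Realization => x.1 i := by
  refine continuous_iff_ofFace.2 fun s => ?_
  by_cases hi : i ∈ (s : Finset ι)
  · simp only [ofFace_apply_of_mem s _ hi]
    exact (_root_.continuous_apply _).comp continuous_subtype_val
  · simp only [ofFace_apply_of_notMem s _ hi]
    exact continuous_const

theorem sum_eq_one_of_support_subset (x : K.Realization) {s : Finset ι} (h : x.1.support ⊆ s) :
    ∑ i ∈ s, x.1 i = 1 := by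
  exact (Finsupp.sum_of_support_subset x.1 h (fun _ a => a) fun _ _ => rfl).symm.trans x.2.2.1

theorem ext_apply {x y : K.Realization} (h : ∀ i, x.1 i = y.1 i) : x = y :=
  Subtype.ext (Finsupp.ext h)

theorem support_nonempty (x : K.Realization) : x.1.support.Nonempty :=
  (K.isRelLowerSet_faces x.2.2.2).1

/-- A map into a realization that stays over finitely many vertices is continuous as soon as its
barycentric coordinates are. -/
theorem continuous_of_apply {Z : Type} [TopologicalSpace Z] {F : Z → L.Realization}
    (T : Finset κ) (hT : ∀ z, (F z).1.support ⊆ T) (hF : ∀ b, Continuous fun z => (F z).1 b) :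
    Continuous F := by
  have : Finite {s : L.faces // (s : Finset κ) ⊆ T} :=
    Finite.of_injective (β := T.powerset) (fun s => ⟨s.1.1, Finset.mem_powerset.2 s.2⟩)
      fun s t h => Subtype.ext (Subtype.ext (Subtype.mk.inj h))
  -- Only finitely many faces lie in T, and the sets where the support of `F z` lies in a given one
  -- are closed, so continuity may be checked on each of them, where `F` factors through a single
  -- closed simplex.
  refine (locallyFinite_of_finite
    fun s : {s : L.faces // (s : Finset κ) ⊆ T} => {z | (F z).1.support ⊆ (s.1 : Finset κ)}).continuous
    ?_ (fun s => ?_) (fun s => ?_)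
  · exact Set.eq_univ_of_forall fun z =>
      Set.mem_iUnion.2 ⟨⟨⟨_, (F z).2.2.2⟩, hT z⟩, Finset.Subset.refl _⟩
  · have : {z | (F z).1.support ⊆ (s.1 : Finset κ)} =
        ⋂ b ∈ {b | b ∉ (s.1 : Finset κ)}, {z | (F z).1 b = 0} := by
      ext z
      simp only [Set.mem_ofPred_eq, Set.mem_iInter, Finset.subset_iff, Finsupp.mem_support_iff]
      exact forall_congr' fun b => not_imp_comm
    rw [this]
    exact isClosed_biInter fun b _ => isClosed_eq (hF b) continuous_const
  · rw [continuousOn_iff_continuous_domRestrict]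
    have hmem (z : {z | (F z).1.support ⊆ (s.1 : Finset κ)}) :
        (fun j : (s.1 : Finset κ) => (F z).1 j) ∈ stdSimplex ℝ (s.1 : Finset κ) := by
      refine ⟨fun j => (F z).2.1 j, ?_⟩
      rw [Finset.sum_coe_sort (s.1 : Finset κ) fun j => (F z).1 j]
      exact sum_eq_one_of_support_subset _ z.2
    have hcont : Continuous fun z : {z | (F z).1.support ⊆ (s.1 : Finset κ)} =>
        ofFace L s.1 ⟨_, hmem z⟩ :=
      (continuous_ofFace s.1).comp <| Continuous.subtype_mk
        (continuous_pi fun j : (s.1 : Finset κ) => (hF j.1).comp continuous_subtype_val) _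
    refine hcont.congr fun z => ext_apply fun b => ?_
    by_cases hb : b ∈ (s.1 : Finset κ)
    · exact ofFace_apply_of_mem s.1 _ hb
    · rw [ofFace_apply_of_notMem s.1 _ hb]
      exact (Finsupp.notMem_support_iff.1 fun h => hb (z.2 h)).symm

theorem sum_pos_of_support_mem_faces {v : κ →₀ ℝ} (h0 : ∀ b, 0 ≤ v b)
    (hv : v.support ∈ L.faces) : 0 < v.sum fun _ a => a :=
  Finset.sum_pos (fun b hb => (h0 b).lt_of_ne' (Finsupp.mem_support_iff.1 hb))
    (L.isRelLowerSet_faces hv).1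

/-- The point of `|L|` whose barycentric coordinates are proportional to `v`. -/
noncomputable def normalize (v : κ →₀ ℝ) (h0 : ∀ b, 0 ≤ v b) (hv : v.support ∈ L.faces) :
    L.Realization :=
  ⟨(v.sum fun _ a => a)⁻¹ • v, by
    have hpos := sum_pos_of_support_mem_faces h0 hv
    refine ⟨fun b => mul_nonneg (inv_nonneg.2 hpos.le) (h0 b), ?_, ?_⟩
    · rw [Finsupp.sum_smul_index fun _ => rfl, ← Finsupp.mul_sum, inv_mul_cancel₀ hpos.ne']
    · rwa [Finsupp.support_smul_eq (inv_ne_zero hpos.ne')]⟩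

theorem support_normalize (v : κ →₀ ℝ) (h0 : ∀ b, 0 ≤ v b) (hv : v.support ∈ L.faces) :
    (normalize v h0 hv).1.support = v.support :=
  Finsupp.support_smul_eq (inv_ne_zero (sum_pos_of_support_mem_faces h0 hv).ne')

theorem normalize_coe (x : L.Realization) (v : κ →₀ ℝ) (h0 : ∀ b, 0 ≤ v b)
    (hv : v.support ∈ L.faces) (h : v = x.1) : normalize v h0 hv = x := by
  subst h
  refine ext_apply fun b => ?_
  simp [normalize, x.2.2.1]

theorem continuous_normalize {Z : Type} [TopologicalSpace Z] {v : Z → κ →₀ ℝ}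
    (h0 : ∀ z b, 0 ≤ v z b) (hv : ∀ z, (v z).support ∈ L.faces) (T : Finset κ)
    (hT : ∀ z, (v z).support ⊆ T) (hc : ∀ b, Continuous fun z => v z b) :
    Continuous fun z => normalize (v z) (h0 z) (hv z) := by
  refine continuous_of_apply T (fun z => (support_normalize _ _ _).trans_subset (hT z)) fun b => ?_
  have hsum : Continuous fun z => (v z).sum fun _ a => a := by
    refine (continuous_finsetSum T fun b _ => hc b).congr fun z => ?_
    exact (Finsupp.sum_of_support_subset (v z) (hT z) (fun _ a => a) fun _ _ => rfl).symm
  exact (hsum.inv₀ fun z => (sum_pos_of_support_mem_faces (h0 z) (hv z)).ne').mul (hc b)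

/-- A map of realizations is finitary if it sends finitely supported sets of points to finitely
supported sets of points. -/
def IsFinitary (F : K.Realization → L.Realization) : Prop :=
  ∀ S : Finset ι, ∃ T : Finset κ, ∀ x, x.1.support ⊆ S → (F x).1.support ⊆ T

theorem IsFinitary.id : IsFinitary (id : K.Realization → K.Realization) :=
  fun S => ⟨S, fun _ h => h⟩

theorem IsFinitary.comp {μ : Type} {M : AbstractSimplicialComplex μ}
    {G : L.Realization → M.Realization} {F : K.Realization → L.Realization}
    (hG : IsFinitary G) (hF : IsFinitary F) : IsFinitary (G ∘ F) := fun S => by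
  obtain ⟨T, hT⟩ := hF S
  obtain ⟨U, hU⟩ := hG T
  exact ⟨U, fun x hx => hU _ (hT x hx)⟩

/-- Two finitary maps such that the supports of the two images of each point span a face are
homotopic, by the straight-line homotopy. -/
theorem homotopic_of_union_support [DecidableEq κ] {F G : C(K.Realization, L.Realization)}
    (hF : IsFinitary F) (hG : IsFinitary G)
    (h : ∀ x, (F x).1.support ∪ (G x).1.support ∈ L.faces) : F.Homotopic G := by
  obtain ⟨v, hvdef⟩ : ∃ v : K.Realization → I → κ →₀ ℝ,
      ∀ x t, v x t = (1 - (t : ℝ)) • (F x).1 + (t : ℝ) • (G x).1 := ⟨_, fun _ _ => rfl⟩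
  have h0 (x t b) : 0 ≤ v x t b := by
    rw [hvdef]
    exact add_nonneg (mul_nonneg (sub_nonneg.2 t.2.2) ((F x).2.1 b)) (mul_nonneg t.2.1 ((G x).2.1 b))
  have hsub (x t) : (v x t).support ⊆ (F x).1.support ∪ (G x).1.support := by
    rw [hvdef]
    exact Finsupp.support_add.trans
      (Finset.union_subset_union Finsupp.support_smul Finsupp.support_smul)
  -- The coordinates of `v x t` sum to (1 - t) + t = 1, so it is not zero.
  have hne (x t) : (v x t).support.Nonempty := by
    rw [Finset.nonempty_iff_ne_empty, Ne, Finsupp.support_eq_empty]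
    intro hv
    have := congrArg (fun w : κ →₀ ℝ => w.sum fun _ a => a) hv
    simp only [hvdef] at this
    rw [Finsupp.sum_add_index' (fun _ => rfl) (fun _ _ _ => rfl),
      Finsupp.sum_smul_index fun _ => rfl, Finsupp.sum_smul_index fun _ => rfl,
      ← Finsupp.mul_sum, ← Finsupp.mul_sum, (F x).2.2.1, (G x).2.2.1] at this
    simp at this
  have hv (x t) : (v x t).support ∈ L.faces := (L.isRelLowerSet_faces (h x)).2 (hsub x t) (hne x t)
  have hcoord {Z : Type} [TopologicalSpace Z] (f : Z → K.Realization) (τ : Z → I)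
      (hf : Continuous f) (hτ : Continuous τ) (b : κ) :
      Continuous fun z => v (f z) (τ z) b := by
    have h1 := (continuous_apply b).comp (F.continuous.comp hf)
    have h2 := (continuous_apply b).comp (G.continuous.comp hf)
    have h3 : Continuous fun z => (τ z : ℝ) := continuous_subtype_val.comp hτ
    simp only [hvdef]
    exact ((continuous_const.sub h3).mul h1).add (h3.mul h2)
  -- The weak topology is tested on simplices of `K`, not on the product of |K| with I. Currying
  -- moves I into the target, so each simplex can be treated separately; local compactness of I
  -- allows uncurrying at the end.
  let c : K.Realization → C(I, L.Realization) := fun x =>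
    ⟨fun t => normalize (v x t) (h0 x t) (hv x t),
      continuous_normalize _ _ _ (hsub x) (hcoord (fun _ => x) _ continuous_const continuous_id)⟩
  have hc : Continuous c := by
    refine continuous_iff_ofFace.2 fun s => ContinuousMap.continuous_of_continuous_uncurry _ ?_
    obtain ⟨S, hS⟩ := hF s
    obtain ⟨T, hT⟩ := hG s
    have hvc (b) : Continuous fun z : stdSimplex ℝ (s : Finset ι) × I =>
        v (ofFace K s z.1) z.2 b :=
      hcoord (Z := stdSimplex ℝ (s : Finset ι) × I) (fun z => ofFace K s z.1) (fun z => z.2)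
        ((continuous_ofFace s).comp continuous_fst) continuous_snd b
    refine continuous_normalize (Z := stdSimplex ℝ (s : Finset ι) × I)
      (v := fun z => v (ofFace K s z.1) z.2) (fun z => h0 _ z.2) (fun z => hv _ z.2) (S ∪ T)
      (fun z => (hsub _ _).trans ?_) hvc
    exact Finset.union_subset_union (hS _ (support_ofFace_subset s z.1))
      (hT _ (support_ofFace_subset s z.1))
  refine ⟨⟨⟨fun p => c p.2 p.1, ?_⟩, fun x => ?_, fun x => ?_⟩⟩
  · exact (ContinuousMap.continuous_uncurry_of_continuous ⟨c, hc⟩).comp continuous_swap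
  · exact normalize_coe _ _ (h0 x 0) (hv x 0) (by simp [hvdef])
  · exact normalize_coe _ _ (h0 x 1) (hv x 1) (by simp [hvdef])

end Realization

end AbstractSimplicialComplex

/-! ### Homotopy invariance of first homology. -/

/-- Homotopy equivalent spaces have isomorphic first singular homology. -/
theorem ContinuousMap.HomotopyEquiv.nonempty_firstHomology_addEquiv {Y Z : Type}
    [TopologicalSpace Y] [TopologicalSpace Z] (e : ContinuousMap.HomotopyEquiv Y Z) :
    Nonempty (firstHomology Y ≃+ firstHomology Z) := by
  let H := (AlgebraicTopology.singularHomologyFunctor AddCommGrpCat.{0} 1).obj (AddCommGrpCat.of ℤ)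
  have key {A B : TopCat.{0}} {f g : A ⟶ B} (h : f.hom.Homotopic g.hom) : H.map f = H.map g :=
    h.elim fun h => TopCat.Homotopy.congr_homologyMap_singularChainComplexFunctor h _ 1
  let i : H.obj (TopCat.of Y) ≅ H.obj (TopCat.of Z) :=
    { hom := H.map (TopCat.ofHom e.toFun)
      inv := H.map (TopCat.ofHom e.invFun)
      hom_inv_id := by
        rw [← H.map_comp, ← H.map_id]
        exact key e.left_inv
      inv_hom_id := by
        rw [← H.map_comp, ← H.map_id]
        exact key e.right_inv }
  exact ⟨i.addCommGroupIsoToAddEquiv⟩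

/-! ### Dowker complexes, and the weights defining the Dowker map. -/

namespace AbstractSimplicialComplex

/-- `K` is the Dowker complex of the relation `R`: its faces are the nonempty finite sets of
elements that have a common related element. -/
def IsDowkerComplex {ι κ : Type} (K : AbstractSimplicialComplex ι) (R : ι → κ → Prop) : Prop :=
  ∀ s : Finset ι, s ∈ K.faces ↔ s.Nonempty ∧ ∃ b, ∀ a ∈ s, R a b

section Weight

variable {ι κ : Type}

open Classical in
/-- The largest coordinate of `t` minus the largest coordinate of `t` at an index not related
to `b`. -/
noncomputable def dowkerWeight (R : ι → κ → Prop) (t : ι →₀ ℝ) (b : κ) : ℝ :=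
  (t.support.sup fun a => (t a).toNNReal : ℝ≥0) -
    ((t.support.filter fun a => ¬ R a b).sup fun a => (t a).toNNReal : ℝ≥0)

variable {R : ι → κ → Prop} {t : ι →₀ ℝ} {b : κ}

theorem dowkerWeight_nonneg : 0 ≤ dowkerWeight R t b := by
  classical
  exact sub_nonneg.2 <| NNReal.coe_le_coe.2 <| Finset.sup_mono <| Finset.filter_subset _ _

/-- If a maximal index a is unrelated to b, the maximum over unrelated indices is already the global
maximum and the difference is zero. -/
theorem rel_of_dowkerWeight_ne_zero (hb : dowkerWeight R t b ≠ 0) {a : ι} (ha : a ∈ t.support)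
    (hmax : ∀ a', t a' ≤ t a) : R a b := by
  classical
  by_contra hR
  refine hb (sub_eq_zero.2 <| congrArg _ <| le_antisymm ?_ ?_)
  · refine (Finset.sup_le fun a' _ => Real.toNNReal_le_toNNReal (hmax a')).trans ?_
    exact Finset.le_sup (f := fun a => (t a).toNNReal) (Finset.mem_filter.2 ⟨ha, hR⟩)
  · exact Finset.sup_mono (Finset.filter_subset _ _)

/-- Nothing is subtracted: the supremum over the empty set is 0 in `ℝ≥0`, leaving the largest
coordinate, which is positive. -/
theorem dowkerWeight_pos (h0 : ∀ a, 0 ≤ t a) (ht : t.support.Nonempty)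
    (hb : ∀ a ∈ t.support, R a b) : 0 < dowkerWeight R t b := by
  classical
  have : t.support.filter (fun a => ¬ R a b) = ∅ :=
    Finset.filter_eq_empty_iff.2 fun a ha => not_not.2 (hb a ha)
  obtain ⟨a, ha⟩ := ht
  have hle := Finset.le_sup (f := fun a => (t a).toNNReal) ha
  have hpos : 0 < (t a).toNNReal :=
    Real.toNNReal_pos.2 ((h0 a).lt_of_ne' (Finsupp.mem_support_iff.1 ha))
  rw [dowkerWeight]
  convert NNReal.coe_pos.2 (hpos.trans_le hle) using 1
  simp only [this, Finset.sup_empty, bot_eq_zero', NNReal.coe_zero, sub_zero]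

theorem exists_max_mem_support (h0 : ∀ a, 0 ≤ t a) (ht : t.support.Nonempty) :
    ∃ a ∈ t.support, ∀ a', t a' ≤ t a := by
  obtain ⟨a, ha, hmax⟩ := t.support.exists_max_image t ht
  refine ⟨a, ha, fun a' => ?_⟩
  by_cases h : a' ∈ t.support
  · exact hmax a' h
  · rw [Finsupp.notMem_support_iff.1 h]
    exact h0 a

/-- Indices outside the support contribute 0, the bottom of `ℝ≥0`. Replacing the varying support by
a fixed finite set makes continuity of the weight visible. -/
theorem sup_filter_support_eq {S : Finset ι} (hS : t.support ⊆ S) (p : ι → Prop)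
    [DecidablePred p] :
    ((t.support.filter p).sup fun a => (t a).toNNReal) =
      (S.filter p).sup fun a => (t a).toNNReal := by
  refine le_antisymm (Finset.sup_mono (Finset.filter_subset_filter _ hS))
    (Finset.sup_le fun a ha => ?_)
  by_cases h : a ∈ t.support
  · exact Finset.le_sup (f := fun a => (t a).toNNReal)
      (Finset.mem_filter.2 ⟨h, (Finset.mem_filter.1 ha).2⟩)
  · simp [Finsupp.notMem_support_iff.1 h]

theorem continuous_dowkerWeight {Z : Type} [TopologicalSpace Z] {u : Z → ι →₀ ℝ} {S : Finset ι}
    (hS : ∀ z, (u z).support ⊆ S) (hu : ∀ a, Continuous fun z => u z a) (R : ι → κ → Prop)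
    (b : κ) : Continuous fun z => dowkerWeight R (u z) b := by
  classical
  have key (p : ι → Prop) [DecidablePred p] : Continuous fun z =>
      (((u z).support.filter p).sup fun a => (u z a).toNNReal : ℝ≥0) := by
    simp only [fun z => sup_filter_support_eq (hS z) p]
    exact Continuous.finset_sup_apply fun a _ => continuous_real_toNNReal.comp (hu a)
  have h1 := key fun _ => True
  simp only [Finset.filter_true] at h1
  unfold dowkerWeight
  exact (NNReal.continuous_coe.comp h1).sub (NNReal.continuous_coe.comp (key fun a => ¬ R a b))

open Classical in
/-- The coordinates, up to normalization, of the image of `t` under the Dowker map from the Dowker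
complex of `R` to that of the converse relation, where `c` chooses common related elements. -/
noncomputable def dowkerVec (R : ι → κ → Prop) (c : Finset ι → κ) (t : ι →₀ ℝ) : κ →₀ ℝ :=
  Finsupp.onFinset (t.support.powerset.image c)
    (fun b => dowkerWeight R t b *
      ∑ Q ∈ t.support.powerset, if c Q = b then ∏ a ∈ Q, t a else 0)
    fun b hb => by
      obtain ⟨Q, hQ, h⟩ := Finset.exists_ne_zero_of_sum_ne_zero (right_ne_zero_of_mul hb)
      exact Finset.mem_image.2 ⟨Q, hQ, by_contra fun h' => h (if_neg h')⟩

variable {c : Finset ι → κ}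

open Classical in
theorem dowkerVec_apply (b : κ) : dowkerVec R c t b = dowkerWeight R t b *
    ∑ Q ∈ t.support.powerset, if c Q = b then ∏ a ∈ Q, t a else 0 := by
  rfl

theorem dowkerVec_nonneg (h0 : ∀ a, 0 ≤ t a) (b : κ) : 0 ≤ dowkerVec R c t b := by
  classical
  rw [dowkerVec_apply]
  refine mul_nonneg dowkerWeight_nonneg (Finset.sum_nonneg fun Q _ => ?_)
  split_ifs
  · exact Finset.prod_nonneg fun a _ => h0 a
  · exact le_rfl

open Classical in
theorem support_dowkerVec_subset {S : Finset ι} (hS : t.support ⊆ S) :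
    (dowkerVec R c t).support ⊆ S.powerset.image c :=
  Finsupp.support_onFinset_subset.trans (Finset.image_subset_image (Finset.powerset_mono.2 hS))

theorem rel_of_mem_support_dowkerVec (hb : b ∈ (dowkerVec R c t).support) {a : ι}
    (ha : a ∈ t.support) (hmax : ∀ a', t a' ≤ t a) : R a b :=
  rel_of_dowkerWeight_ne_zero (left_ne_zero_of_mul (Finsupp.mem_support_iff.1 hb)) ha hmax

/-- The vertex chosen for the whole support survives: its weight is positive, and the term Q =
`t.support` is a product of positive coordinates among nonnegative terms. -/
theorem support_dowkerVec_nonempty (h0 : ∀ a, 0 ≤ t a) (ht : t.support.Nonempty)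
    (hc : ∀ a ∈ t.support, R a (c t.support)) : (dowkerVec R c t).support.Nonempty := by
  classical
  refine ⟨c t.support, Finsupp.mem_support_iff.2 ?_⟩
  rw [dowkerVec_apply]
  refine (mul_pos (dowkerWeight_pos h0 ht hc) ?_).ne'
  refine Finset.sum_pos' (fun Q _ => ?_) ⟨t.support, Finset.mem_powerset_self _, ?_⟩
  · split_ifs
    · exact Finset.prod_nonneg fun a _ => h0 a
    · exact le_rfl
  · rw [if_pos rfl]
    exact Finset.prod_pos fun a ha => (h0 a).lt_of_ne' (Finsupp.mem_support_iff.1 ha)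

/-- A monomial over Q vanishes once Q leaves the support, so the sum over subsets of the varying
support equals the sum over subsets of the fixed set S, a polynomial in the coordinates. -/
theorem continuous_dowkerVec {Z : Type} [TopologicalSpace Z] {u : Z → ι →₀ ℝ} {S : Finset ι}
    (hS : ∀ z, (u z).support ⊆ S) (hu : ∀ a, Continuous fun z => u z a) (R : ι → κ → Prop)
    (c : Finset ι → κ) (b : κ) : Continuous fun z => dowkerVec R c (u z) b := by
  classical
  simp only [dowkerVec_apply]
  refine (continuous_dowkerWeight hS hu R b).mul ?_
  have (z : Z) : (∑ Q ∈ (u z).support.powerset, if c Q = b then ∏ a ∈ Q, u z a else 0) =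
      ∑ Q ∈ S.powerset, if c Q = b then ∏ a ∈ Q, u z a else 0 := by
    refine Finset.sum_subset (Finset.powerset_mono.2 (hS z)) fun Q _ hQ => ?_
    obtain ⟨a, ha, ha'⟩ := Finset.not_subset.1 (mt Finset.mem_powerset.2 hQ)
    rw [Finset.prod_eq_zero ha (Finsupp.notMem_support_iff.1 ha'), ite_self]
  simp only [this]
  refine continuous_finsetSum _ fun Q _ => ?_
  split_ifs
  · exact continuous_finsetProd _ fun a _ => hu a
  · exact continuous_const

end Weight

/-! ### Dowker duality. -/

namespace IsDowkerComplex

open Realization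

variable {ι κ : Type} {K : AbstractSimplicialComplex ι} {L : AbstractSimplicialComplex κ}
  {R : ι → κ → Prop}

theorem exists_choice [Nonempty κ] (hK : K.IsDowkerComplex R) :
    ∃ c : Finset ι → κ, ∀ s ∈ K.faces, ∀ a ∈ s, R a (c s) := by
  have (s : Finset ι) : ∃ b, s ∈ K.faces → ∀ a ∈ s, R a b := by
    by_cases hs : s ∈ K.faces
    · obtain ⟨b, hb⟩ := ((hK s).1 hs).2
      exact ⟨b, fun _ => hb⟩
    · exact ⟨Classical.arbitrary κ, fun h => absurd h hs⟩
  choose c hc using this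
  exact ⟨c, hc⟩

/-- An index where x is maximal is related to every vertex in the support of the image. -/
theorem support_dowkerVec_mem_faces (hL : L.IsDowkerComplex (flip R)) {c : Finset ι → κ}
    (hc : ∀ s ∈ K.faces, ∀ a ∈ s, R a (c s)) (x : K.Realization) :
    (dowkerVec R c x.1).support ∈ L.faces := by
  obtain ⟨a, ha, hmax⟩ := exists_max_mem_support x.2.1 (support_nonempty x)
  exact (hL _).2 ⟨support_dowkerVec_nonempty x.2.1 (support_nonempty x) (hc _ x.2.2.2),
    a, fun b hb => rel_of_mem_support_dowkerVec hb ha hmax⟩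

/-- The Dowker map from the realization of the Dowker complex of `R` to the realization of the
Dowker complex of the converse relation. -/
noncomputable def map (hL : L.IsDowkerComplex (flip R)) {c : Finset ι → κ}
    (hc : ∀ s ∈ K.faces, ∀ a ∈ s, R a (c s)) : C(K.Realization, L.Realization) where
  toFun x := normalize (dowkerVec R c x.1) (dowkerVec_nonneg x.2.1)
    (hL.support_dowkerVec_mem_faces hc x)
  continuous_toFun := by
    classical
    refine continuous_iff_ofFace.2 fun s => ?_
    exact continuous_normalize _ _ _
      (fun z => support_dowkerVec_subset (support_ofFace_subset s z))
      (continuous_dowkerVec (support_ofFace_subset s)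
        (fun a => (continuous_apply a).comp (continuous_ofFace s)) R c)

theorem support_map (hL : L.IsDowkerComplex (flip R)) {c : Finset ι → κ}
    (hc : ∀ s ∈ K.faces, ∀ a ∈ s, R a (c s)) (x : K.Realization) :
    (hL.map hc x).1.support = (dowkerVec R c x.1).support :=
  support_normalize (dowkerVec R c x.1) (dowkerVec_nonneg x.2.1)
    (hL.support_dowkerVec_mem_faces hc x)

theorem rel_of_mem_support_map (hL : L.IsDowkerComplex (flip R)) {c : Finset ι → κ}
    (hc : ∀ s ∈ K.faces, ∀ a ∈ s, R a (c s)) {x : K.Realization} {a : ι}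
    (ha : a ∈ x.1.support) (hmax : ∀ a', x.1 a' ≤ x.1 a) {b : κ}
    (hb : b ∈ (hL.map hc x).1.support) : R a b :=
  rel_of_mem_support_dowkerVec ((hL.support_map hc x).subset hb) ha hmax

theorem isFinitary_map (hL : L.IsDowkerComplex (flip R)) {c : Finset ι → κ}
    (hc : ∀ s ∈ K.faces, ∀ a ∈ s, R a (c s)) : IsFinitary (hL.map hc) := fun S => by
  classical
  exact ⟨_, fun x hx => (hL.support_map hc x).trans_subset (support_dowkerVec_subset hx)⟩

/-- The Dowker map followed by the Dowker map of the converse relation is homotopic to the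
identity. -/
theorem map_comp_map_homotopic_id (hK : K.IsDowkerComplex R) (hL : L.IsDowkerComplex (flip R))
    {c : Finset ι → κ} (hc : ∀ s ∈ K.faces, ∀ a ∈ s, R a (c s))
    {d : Finset κ → ι} (hd : ∀ s ∈ L.faces, ∀ b ∈ s, R (d s) b) :
    ((map (R := flip R) hK hd).comp (hL.map hc)).Homotopic (ContinuousMap.id _) := by
  classical
  let f := hL.map hc
  -- The intermediate map reweights x by the weights of `f x`. Its support stays inside that of x,
  -- linking it to the identity; it also consists of elements related to each maximal vertex of `f
  -- x`, linking it to the composite.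
  let w : K.Realization → ι →₀ ℝ := fun x => Finsupp.onFinset x.1.support
    (fun a => x.1 a * dowkerWeight (flip R) (f x).1 a)
    fun a ha => Finsupp.mem_support_iff.2 (left_ne_zero_of_mul ha)
  have hw0 (x a) : 0 ≤ w x a := mul_nonneg (x.2.1 a) dowkerWeight_nonneg
  have hsub (x) : (w x).support ⊆ x.1.support := Finsupp.support_onFinset_subset
  have hrel {x a} (ha : a ∈ (w x).support) {b} (hb : b ∈ (f x).1.support)
      (hmax : ∀ b', (f x).1 b' ≤ (f x).1 b) : R a b :=
    rel_of_dowkerWeight_ne_zero (R := flip R)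
      (right_ne_zero_of_mul (Finsupp.mem_support_iff.1 ha)) hb hmax
  have hne (x) : (w x).support.Nonempty := by
    -- A maximal vertex of x is related to all of the support of `f x`, so its weight there is
    -- positive.
    obtain ⟨a, ha, hmax⟩ := exists_max_mem_support x.2.1 (support_nonempty x)
    refine ⟨a, Finsupp.mem_support_iff.2 (mul_ne_zero (Finsupp.mem_support_iff.1 ha) ?_)⟩
    refine (dowkerWeight_pos (f x).2.1 (support_nonempty _) fun b hb => ?_).ne'
    exact hL.rel_of_mem_support_map hc ha hmax hb
  have hw (x) : (w x).support ∈ K.faces := (K.isRelLowerSet_faces x.2.2.2).2 (hsub x) (hne x)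
  let h : C(K.Realization, K.Realization) :=
    ⟨fun x => normalize (w x) (hw0 x) (hw x), continuous_iff_ofFace.2 fun s => by
      obtain ⟨T, hT⟩ := hL.isFinitary_map hc s
      refine continuous_normalize _ _ s
        (fun z => (hsub _).trans (support_ofFace_subset s z)) fun a => ?_
      refine ((continuous_apply a).comp (continuous_ofFace s)).mul ?_
      exact continuous_dowkerWeight (fun z => hT _ (support_ofFace_subset s z))
        (fun b => (continuous_apply b).comp (f.continuous.comp (continuous_ofFace s))) _ a⟩
  have hsupp (x) : (h x).1.support = (w x).support := support_normalize (w x) (hw0 x) (hw x)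
  have hfin : IsFinitary h := fun S => ⟨S, fun x hx => by
    rw [hsupp]
    exact (hsub x).trans hx⟩
  refine ContinuousMap.Homotopic.trans (g := h) ?_ ?_
  · have hgf : IsFinitary ((map (R := flip R) hK hd).comp f) :=
      (isFinitary_map (R := flip R) hK hd).comp (hL.isFinitary_map hc)
    refine homotopic_of_union_support hgf hfin
      fun x => (hK _).2 ⟨(support_nonempty _).mono Finset.subset_union_left, ?_⟩
    -- A maximal vertex b of `f x` is the common witness for both supports.
    obtain ⟨b, hb, hmax⟩ := exists_max_mem_support (f x).2.1 (support_nonempty _)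
    refine ⟨b, fun a ha => ?_⟩
    rcases Finset.mem_union.1 ha with ha | ha
    · exact rel_of_mem_support_map (R := flip R) hK hd (x := f x) hb hmax ha
    · exact hrel ((hsupp x).subset ha) hb hmax
  · refine homotopic_of_union_support hfin IsFinitary.id fun x => ?_
    rw [hsupp]
    exact Set.mem_of_eq_of_mem (Finset.union_eq_right.2 (hsub x)) x.2.2.2

/-- **Dowker duality**: the Dowker complexes of a relation and of its converse have homotopy
equivalent realizations. -/
theorem nonempty_homotopyEquiv [Nonempty ι] [Nonempty κ] (hK : K.IsDowkerComplex R)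
    (hL : L.IsDowkerComplex (flip R)) :
    Nonempty (ContinuousMap.HomotopyEquiv K.Realization L.Realization) := by
  obtain ⟨c, hc⟩ := hK.exists_choice
  obtain ⟨d, hd⟩ := hL.exists_choice
  exact ⟨⟨hL.map hc, map (R := flip R) hK hd, map_comp_map_homotopic_id hK hL hc hd,
    map_comp_map_homotopic_id (R := flip R) hL hK hd hc⟩⟩

end IsDowkerComplex

end AbstractSimplicialComplex

/-! ### The divisibility relation and the conclusion. -/

theorem isDowkerComplex_commonDivisorComplex (X : Set ℕ+) :
    (commonDivisorComplex X).IsDowkerComplex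
      fun v (p : {p : ℕ // p.Prime ∧ ∃ x ∈ X, x ≠ 1 ∧ p ∣ (x : ℕ)}) => (p : ℕ) ∣ (v.1 : ℕ) := by
  refine fun s => and_congr_right fun ⟨v, hv⟩ => ⟨fun h => ?_, fun ⟨p, hp⟩ => ?_⟩
  · obtain ⟨p, hp, hdvd⟩ := Nat.exists_prime_and_dvd (ne_of_gt h)
    exact ⟨⟨p, hp, v, v.2.1, v.2.2, hdvd.trans (Finset.gcd_dvd hv)⟩,
      fun w hw => hdvd.trans (Finset.gcd_dvd hw)⟩
  · exact p.2.1.one_lt.trans_le <| Nat.le_of_dvd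
      (Nat.pos_of_dvd_of_pos (Finset.gcd_dvd hv) v.1.pos) (Finset.dvd_gcd hp)

theorem isDowkerComplex_primeDivisorComplex (X : Set ℕ+) :
    (primeDivisorComplex X).IsDowkerComplex
      fun p (v : {x : ℕ+ // x ∈ X ∧ x ≠ 1}) => (p : ℕ) ∣ (v.1 : ℕ) := by
  refine fun s => and_congr_right fun ⟨p, hp⟩ => ⟨fun ⟨x, hx, h⟩ => ?_, fun ⟨v, h⟩ => ?_⟩
  · refine ⟨⟨x, hx, ?_⟩, h⟩
    -- The witness x may be any element of X, but no prime divides 1, so nonemptiness of s puts x in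
    -- X*.
    rintro rfl
    exact p.2.1.one_lt.ne' (Nat.dvd_one.1 (h p hp))
  · exact ⟨v, v.2.1, h⟩

theorem mainTheorem2 (X : Set ℕ+) (hX : ConnectedSpace (commonDivisorComplex X).Realization) :
    Nonempty (firstHomology (commonDivisorComplex X).Realization ≃+
      firstHomology (primeDivisorComplex X).Realization) := by
  obtain ⟨x⟩ := hX.toNonempty
  -- A point of the realization has a face as support, which contains a number and has a common
  -- prime divisor; both vertex types are thus inhabited, as the choice functions require.
  obtain ⟨⟨v, -⟩, p, -⟩ := (isDowkerComplex_commonDivisorComplex X _).1 x.2.2.2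
  have : Nonempty {x : ℕ+ // x ∈ X ∧ x ≠ 1} := ⟨v⟩
  have : Nonempty {p : ℕ // p.Prime ∧ ∃ x ∈ X, x ≠ 1 ∧ p ∣ (x : ℕ)} := ⟨p⟩
  obtain ⟨e⟩ := (isDowkerComplex_commonDivisorComplex X).nonempty_homotopyEquiv
    (isDowkerComplex_primeDivisorComplex X)
  exact e.nonempty_firstHomology_addEquiv
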